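/- Let $p$ be a prime and let $B$ be the quaternion algebra over $\mathbb{Q}$ ramified exactly at $p$ and $\infty$, with reduced norm $\operatorname{nrd}$. For maximal orders $\mathfrak{O},\mathfrak{O}'\subseteq B$ let $d(\mathfrak{O},\mathfrak{O}')$ be the index $|\mathfrak{O}':\mathfrak{O}\cap\mathfrak{O}'|$ (which equals $|\mathfrak{O}:\mathfrak{O}\cap\mathfrak{O}'|$). A quadratic order $\mathcal{O}$ is said to be optimally embedded in $\mathfrak{O}$ if $\mathcal{O}\cong\mathfrak{O}\cap L$ for some subfield $L\subseteq B$. Let $K$ be an imaginary quadratic field with ring of integers $\mathcal{O}_K$, let $\beta\in\mathcal{O}_K\setminus\mathbb{Z}$, and let $\ell$ be a prime. Suppose that $\mathfrak{O}$ and $\mathfrak{O}'$ are maximal orders of $B$ in which $\mathbb{Z}[\ell\beta]$ and $\mathbb{Z}[\beta]$, respectively, are optimally embedded. If $d(\mathfrak{O},\mathfrak{O}')$ is not divisible by $\ell$, then $$d(\mathfrak{O},\mathfrak{O}')\ \geq\ \frac{p}{4\,\ell\,\operatorname{nrd}(\beta)},$$ where $\operatorname{nrd}(\beta)$ is the reduced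 norm of the image of $\beta$ under any embedding $K\hookrightarrow B$ (such an embedding exists under these hypotheses, and the value is $N_{K/\mathbb{Q}}(\beta)$). -/

import Mathlib

open scoped Quaternion NumberField

namespace QuatOrder

/-- The quaternion algebra `(a, b | ℚ)`, with basis `1, i, j, k = ij` and `i² = a`, `j² = b`,
`ij = -ji`, base changed to an extension field `F` of `ℚ`, i.e. `F ⊗ (a, b | ℚ) = (a, b | F)`. -/
abbrev BaseChange (a b : ℚ) (F : Type*) [Field F] [Algebra ℚ F] : Type _ :=
  ℍ[F, algebraMap ℚ F a, algebraMap ℚ F b]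

/-- For `F` the completion of `ℚ` at a place `v`: the quaternion algebra `(a, b | ℚ)` is ramified
at `v`, that is, its base change to `F` is a division algebra. -/
def IsRamifiedOver (a b : ℚ) (F : Type*) [Field F] [Algebra ℚ F] : Prop :=
  ∀ x : BaseChange a b F, x ≠ 0 → IsUnit x

/-- `(a, b | ℚ)` is a quaternion algebra which ramifies exactly at the prime `p` and at `∞`. -/
structure RamifiesExactlyAt (a b : ℚ) (p : ℕ) : Prop where
  ne_zero_left : a ≠ 0
  ne_zero_right : b ≠ 0
  finite_places : ∀ (q : ℕ) [Fact q.Prime], IsRamifiedOver a b ℚ_[q] ↔ q = p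
  infinite_place : IsRamifiedOver a b ℝ

variable {a b : ℚ}

/-- The reduced norm `nrd α = α * conj α`. This product is always a rational scalar
(`QuaternionAlgebra.mul_star_eq_coe`), of which we take the value in `ℚ`. -/
def nrd (α : ℍ[ℚ, a, b]) : ℚ := (α * star α).re

/-- A subring of `B = (a, b | ℚ)` is an order if its additive group is generated by a basis of the
`ℚ`-vector space `B`. -/
def IsOrder (O : Subring ℍ[ℚ, a, b]) : Prop :=
  ∃ e : Module.Basis (Fin 4) ℚ ℍ[ℚ, a, b],
    O.toAddSubgroup = AddSubgroup.closure (Set.range e)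

/-- An order is maximal if no order properly contains it. -/
def IsMaximalOrder (O : Subring ℍ[ℚ, a, b]) : Prop :=
  IsOrder O ∧ ∀ O' : Subring ℍ[ℚ, a, b], IsOrder O' → O ≤ O' → O' = O

/-- The quadratic order `R` is optimally embedded in `O` if `R ≅ O ∩ L` for some subfield `L` of
the quaternion algebra. -/
def IsOptimallyEmbedded (R : Type*) [CommRing R] (O : Subring ℍ[ℚ, a, b]) : Prop :=
  ∃ L : Subring ℍ[ℚ, a, b], IsField L ∧ Nonempty (R ≃+* ↥(O ⊓ L))

/-- The distance `d(O, O')` between two maximal orders: the index `|O' : O ∩ O'|`. (For maximal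
orders it is the same as `|O : O ∩ O'|`.) -/
noncomputable def orderDist (O O' : Subring ℍ[ℚ, a, b]) : ℕ :=
  (O ⊓ O').toAddSubgroup.relIndex O'.toAddSubgroup

end QuatOrder

/-!
The argument compares the two embedded quadratic orders inside the quaternion algebra `B`. Let `y` be
the image of `β` in `O'`, and let `x` be the element of `B` such that `ℓ x` is the image of `ℓ β` in
`O`. Both have the reduced trace `t` and the reduced norm `n` of `β` (`trd_nrd_map`). Write `N` for
the distance; then `N y` and `N (star y)` lie in `O` (`orderDist_nsmul_mem`).

Since `ℤ[ℓ β]` is optimally embedded, `x ∉ O`; as `ℓ` and `N` are coprime while `ℓ x` lies in `O`,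
it follows that `x` is neither `y` nor `star y`. The form `nrd` is positive definite because `B`
ramifies at infinity, so `nrd (x - y)` and `nrd (x - star y)` are positive. Their sum is
`4 n - t ^ 2 ≤ 4 n`, and their product is `nrd (x y - y x)` (`nrd_commutator`). Multiplied by `ℓ N`
they become integers, being expressible through reduced traces of elements of `O`, and the product
of these integers is the reduced norm of the commutator of `ℓ x` and `N y`, two elements of `O`.

Such a norm is divisible by `p` (`dvd_nrd_commutator`): otherwise the norm form on the lattice
spanned by `1, u, v, uv`, for `u, v` in `O` with commutator of norm prime to `p`, has Gram determinant
prime to `p`, so that a nontrivial zero modulo `p`, which exists by Chevalley–Warning, lifts by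
Hensel's lemma to a nonzero element of norm zero in the division algebra `B ⊗ ℚ_[p]`. Hence `p`
divides one of the two positive integers, and `p ≤ 4 ℓ N n` (`le_of_mem_order`).
-/

namespace QuatOrder

variable {a b : ℚ}

/-! ### Reduced trace and reduced norm -/

/-- The reduced trace `α + conj α`, as a rational number. -/
def trd (α : ℍ[ℚ, a, b]) : ℚ := 2 * α.re

lemma nrd_eq (z : ℍ[ℚ, a, b]) :
    nrd z = z.re ^ 2 - a * z.imI ^ 2 - b * z.imJ ^ 2 + a * b * z.imK ^ 2 := by
  simp [nrd]; ring

lemma add_star_self (z : ℍ[ℚ, a, b]) : z + star z = algebraMap ℚ _ (trd z) := by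
  ext <;> simp [trd, QuaternionAlgebra.algebraMap_eq]; ring

lemma sq_eq (z : ℍ[ℚ, a, b]) :
    z * z = algebraMap ℚ _ (trd z) * z - algebraMap ℚ _ (nrd z) := by
  ext <;> simp [trd, nrd_eq, QuaternionAlgebra.algebraMap_eq] <;> ring

lemma nrd_mul (y z : ℍ[ℚ, a, b]) : nrd (y * z) = nrd y * nrd z := by
  simp only [nrd_eq, QuaternionAlgebra.re_mul, QuaternionAlgebra.imI_mul,
    QuaternionAlgebra.imJ_mul, QuaternionAlgebra.imK_mul]
  ring

/-- A quaternion outside `ℚ` satisfies only one monic quadratic equation over `ℚ`, whose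
coefficients are therefore its reduced trace and norm. -/
lemma trd_nrd_eq_of_sq_eq {z : ℍ[ℚ, a, b]} (hz : ∀ r : ℚ, z ≠ algebraMap ℚ _ r) {t n : ℚ}
    (h : z * z = algebraMap ℚ _ t * z - algebraMap ℚ _ n) : trd z = t ∧ nrd z = n := by
  have h1 := sq_eq z
  rw [h] at h1
  have h2 : algebraMap ℚ ℍ[ℚ, a, b] (trd z - t) * z = algebraMap ℚ _ (nrd z - n) := by
    rw [map_sub, map_sub, sub_mul]
    rw [sub_eq_sub_iff_add_eq_add] at h1 ⊢
    rw [← h1]; abel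
  have ht : trd z = t := by
    by_contra hne
    have hne' : trd z - t ≠ 0 := sub_ne_zero.2 hne
    apply hz ((trd z - t)⁻¹ * (nrd z - n))
    rw [map_mul, ← h2, ← mul_assoc, ← map_mul, inv_mul_cancel₀ hne', map_one, one_mul]
  refine ⟨ht, ?_⟩
  rw [ht, sub_self, map_zero, zero_mul] at h2
  have := congrArg QuaternionAlgebra.re h2
  simp [QuaternionAlgebra.algebraMap_eq] at this
  linarith

/-- An element of an order is integral over `ℤ`, so by Gauss's lemma its reduced characteristic
polynomial has integral coefficients. -/
lemma exists_int_trd_nrd {O : Subring ℍ[ℚ, a, b]} (hO : IsOrder O) {z : ℍ[ℚ, a, b]}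
    (hz : z ∈ O) : (∃ t : ℤ, trd z = t) ∧ ∃ n : ℤ, nrd z = n := by
  obtain ⟨e, he⟩ := hO
  have hfin : Module.Finite ℤ O := by
    have : AddGroup.FG O.toAddSubgroup :=
      (AddGroup.fg_iff_addSubgroup_fg _).2
        ⟨(Set.finite_range e).toFinset, by rw [he]; simp⟩
    exact (Module.Finite.iff_addGroup_fg (G := O)).2 this
  have hint : IsIntegral ℤ z :=
    (IsIntegral.of_finite ℤ (⟨z, hz⟩ : O)).map O.subtype.toIntAlgHom
  by_cases hr : ∃ r : ℚ, z = algebraMap ℚ _ r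
  · obtain ⟨r, rfl⟩ := hr
    obtain ⟨m, rfl⟩ := IsIntegrallyClosed.isIntegral_iff.1
      ((isIntegral_algebraMap_iff (RingHom.injective _)).1 hint)
    refine ⟨⟨2 * m, ?_⟩, ⟨m ^ 2, ?_⟩⟩
    · simp [trd]
    · simp [nrd_eq]
  · push Not at hr
    obtain ⟨f, hf, hfz⟩ := hint
    -- the characteristic polynomial of `z` divides the monic integral polynomial `f`, so Gauss's
    -- lemma applies to it
    let g : Polynomial ℚ := .X ^ 2 + (.C (-trd z) * .X + .C (nrd z))
    have hgd : (Polynomial.C (-trd z) * .X + .C (nrd z)).degree < ((2 : ℕ) : WithBot ℕ) :=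
      lt_of_le_of_lt Polynomial.degree_linear_le (by decide)
    have hg : g.Monic := Polynomial.monic_X_pow_add hgd
    have hgz : Polynomial.aeval z g = 0 := by
      simp only [g, map_add, map_mul, map_pow, Polynomial.aeval_X, Polynomial.aeval_C, map_neg]
      rw [pow_two, sq_eq]
      simp
    have hgdeg : g.degree = (2 : ℕ) := by
      rw [← Polynomial.degree_X_pow (R := ℚ) 2]
      exact Polynomial.degree_add_eq_left_of_degree_lt
        (p := (Polynomial.X ^ 2 : Polynomial ℚ)) (hgd.trans_eq (Polynomial.degree_X_pow 2).symm)
    set F := f.map (algebraMap ℤ ℚ) with hF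
    have hFz : Polynomial.aeval z F = 0 := by
      rw [hF, Polynomial.aeval_map_algebraMap]; exact hfz
    have hmod : Polynomial.aeval z (F %ₘ g) = 0 := by
      have h := congrArg (Polynomial.aeval z) (Polynomial.modByMonic_add_div F g)
      rwa [map_add, map_mul, hgz, zero_mul, add_zero, hFz] at h
    have hg2 : g.natDegree = 2 := Polynomial.natDegree_eq_of_degree_eq_some hgdeg
    have hlt : (F %ₘ g).natDegree < 2 :=
      hg2 ▸ Polynomial.natDegree_modByMonic_lt F hg fun h => by simp [h] at hg2
    obtain ⟨c, d, hlin⟩ :=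
      Polynomial.exists_eq_X_add_C_of_natDegree_le_one (Nat.le_of_lt_succ hlt)
    rw [hlin] at hmod
    simp only [map_add, map_mul, Polynomial.aeval_X, Polynomial.aeval_C] at hmod
    have hc : c = 0 := by
      by_contra hc
      apply hr (c⁻¹ * -d)
      rw [map_mul, map_neg, ← eq_neg_of_add_eq_zero_left hmod, ← mul_assoc, ← map_mul,
        inv_mul_cancel₀ hc, map_one, one_mul]
    have hd : d = 0 := by
      rw [hc, map_zero, zero_mul, zero_add] at hmod
      simpa [QuaternionAlgebra.algebraMap_eq] using congrArg QuaternionAlgebra.re hmod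
    have hdvd : g ∣ F := by
      rw [← Polynomial.modByMonic_eq_zero_iff_dvd hg, hlin, hc, hd]; simp
    obtain ⟨g', hg'⟩ := IsIntegrallyClosed.eq_map_mul_C_of_dvd ℚ hf hdvd
    rw [hg.leadingCoeff, map_one, mul_one] at hg'
    have h0 := congrArg (Polynomial.coeff · 0) hg'
    have h1 := congrArg (Polynomial.coeff · 1) hg'
    simp [g, Polynomial.coeff_X, Polynomial.coeff_X_pow, Polynomial.coeff_C] at h0 h1
    exact ⟨⟨-g'.coeff 1, by push_cast; linarith⟩, ⟨g'.coeff 0, h0.symm⟩⟩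

/-! ### The place at infinity -/

/-- If `a` or `b` were nonnegative, `√a + i` or `√b + j` would be a zero divisor over `ℝ`. So the
norm form of an algebra ramified at infinity is positive definite. -/
lemma neg_of_isRamifiedOver_real (h : IsRamifiedOver a b ℝ) :
    a < 0 ∧ b < 0 := by
  constructor
  · by_contra hlt
    have h0 : (0 : ℝ) ≤ (a : ℝ) := by exact_mod_cast not_lt.1 hlt
    have hs := Real.mul_self_sqrt h0
    let x : BaseChange a b ℝ := ⟨Real.sqrt a, 1, 0, 0⟩
    let y : BaseChange a b ℝ := ⟨Real.sqrt a, -1, 0, 0⟩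
    have hxy : x * y = 0 := by
      ext <;> simp [x, y, hs]
    have hx : IsUnit x := h x fun h0 => by simpa [x] using congrArg QuaternionAlgebra.imI h0
    have hy := hx.mul_right_eq_zero.1 hxy
    simpa [y] using congrArg QuaternionAlgebra.imI hy
  · by_contra hlt
    have h0 : (0 : ℝ) ≤ (b : ℝ) := by exact_mod_cast not_lt.1 hlt
    have hs := Real.mul_self_sqrt h0
    let x : BaseChange a b ℝ := ⟨Real.sqrt b, 0, 1, 0⟩
    let y : BaseChange a b ℝ := ⟨Real.sqrt b, 0, -1, 0⟩
    have hxy : x * y = 0 := by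
      ext <;> simp [x, y, hs]
    have hx : IsUnit x := h x fun h0 => by simpa [x] using congrArg QuaternionAlgebra.imJ h0
    have hy := hx.mul_right_eq_zero.1 hxy
    simpa [y] using congrArg QuaternionAlgebra.imJ hy

lemma nrd_pos (ha : a < 0) (hb : b < 0) {z : ℍ[ℚ, a, b]} (hz : z ≠ 0) : 0 < nrd z := by
  have hab := mul_pos_of_neg_of_neg ha hb
  rw [nrd_eq]
  have h0 := sq_nonneg z.re
  have h1 := mul_nonneg (neg_nonneg.2 ha.le) (sq_nonneg z.imI)
  have h2 := mul_nonneg (neg_nonneg.2 hb.le) (sq_nonneg z.imJ)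
  have h3 := mul_nonneg hab.le (sq_nonneg z.imK)
  by_contra hle
  have e0 : z.re ^ 2 = 0 := by linarith
  have e1 : -a * z.imI ^ 2 = 0 := by linarith
  have e2 : -b * z.imJ ^ 2 = 0 := by linarith
  have e3 : a * b * z.imK ^ 2 = 0 := by linarith
  apply hz
  ext
  · simpa using e0
  · simpa [ha.ne] using e1
  · simpa [hb.ne] using e2
  · simpa [ha.ne, hb.ne] using e3

/-! ### The place `p` -/

/-- The form `nrd (c₀ + c₁ x + c₂ y + c₃ xy)` for quaternions `x`, `y` of reduced traces `t`, `u`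
and reduced norms `m`, `n`, where `w` is the reduced trace of `xy`. -/
def normForm {R : Type*} [CommRing R] (t u w m n : R) (c : Fin 4 → R) : R :=
  c 0 ^ 2 + m * c 1 ^ 2 + n * c 2 ^ 2 + m * n * c 3 ^ 2 + t * c 0 * c 1 + u * c 0 * c 2
    + w * c 0 * c 3 + (t * u - w) * c 1 * c 2 + m * u * c 1 * c 3 + n * t * c 2 * c 3

/-- The Gram matrix of the bilinear form polar to `normForm`. -/
def gram {R : Type*} [CommRing R] (t u w m n : R) : Matrix (Fin 4) (Fin 4) R :=
  !![2, t, u, w; t, 2 * m, t * u - w, m * u; u, t * u - w, 2 * n, n * t;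
    w, m * u, n * t, 2 * m * n]

/-- The reduced norm of the commutator of `x` and `y`, in the parameters of `normForm`. -/
def commNorm {R : Type*} [CommRing R] (t u w m n : R) : R :=
  4 * m * n - t ^ 2 * n - u ^ 2 * m - w ^ 2 + t * u * w

lemma det_gram {R : Type*} [CommRing R] (t u w m n : R) :
    (gram t u w m n).det = commNorm t u w m n ^ 2 := by
  simp [gram, commNorm, Matrix.det_succ_row_zero, Fin.sum_univ_succ, Fin.succAbove]
  ring

lemma normForm_add_single {R : Type*} [CommRing R] (t u w m n : R) (c : Fin 4 → R)
    (i : Fin 4) (s : R) :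
    normForm t u w m n (c + Pi.single i s) = normForm t u w m n c
      + (gram t u w m n).mulVec c i * s + normForm t u w m n (Pi.single i 1) * s ^ 2 := by
  fin_cases i <;>
    simp [normForm, gram, Matrix.mulVec, dotProduct, Fin.sum_univ_succ] <;> ring

lemma gram_mulVec_add_single {R : Type*} [CommRing R] (t u w m n : R) (c : Fin 4 → R)
    (i : Fin 4) (s : R) :
    (gram t u w m n).mulVec (c + Pi.single i s) i
      = (gram t u w m n).mulVec c i + 2 * normForm t u w m n (Pi.single i 1) * s := by
  fin_cases i <;>
    simp [normForm, gram, Matrix.mulVec, dotProduct, Fin.sum_univ_succ] <;> ring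

lemma intCast_normForm (R : Type*) [CommRing R] (t u w m n : ℤ) (c : Fin 4 → ℤ) :
    ((normForm t u w m n c : ℤ) : R) = normForm (t : R) u w m n (fun j => (c j : R)) := by
  simp [normForm]

lemma intCast_gram_mulVec (R : Type*) [CommRing R] (t u w m n : ℤ) (c : Fin 4 → ℤ) (i : Fin 4) :
    (((gram t u w m n).mulVec c i : ℤ) : R)
      = (gram (t : R) u w m n).mulVec (fun j => (c j : R)) i := by
  fin_cases i <;> simp [gram, Matrix.mulVec, dotProduct, Fin.sum_univ_succ]

/-- A quadratic form in four variables over a finite field has a nontrivial zero, by Chevalley–Warning. -/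
lemma exists_normForm_eq_zero (p : ℕ) [Fact p.Prime] (t u w m n : ZMod p) :
    ∃ c : Fin 4 → ZMod p, c ≠ 0 ∧ normForm t u w m n c = 0 := by
  classical
  let f : MvPolynomial (Fin 4) (ZMod p) :=
    normForm (R := MvPolynomial (Fin 4) (ZMod p)) (.C t) (.C u) (.C w) (.C m) (.C n) MvPolynomial.X
  have heval (c) : MvPolynomial.eval c f = normForm t u w m n c := by simp [f, normForm]
  have hhom : f.IsHomogeneous 2 := by
    have hX (i : Fin 4) := MvPolynomial.isHomogeneous_X (ZMod p) i
    have hC (r : ZMod p) := MvPolynomial.isHomogeneous_C (Fin 4) r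
    have h2 (r : MvPolynomial (Fin 4) (ZMod p)) (hr : r.IsHomogeneous 0) (i j : Fin 4) :
        (r * MvPolynomial.X i * MvPolynomial.X j).IsHomogeneous 2 := (hr.mul (hX i)).mul (hX j)
    have h1 (r : MvPolynomial (Fin 4) (ZMod p)) (hr : r.IsHomogeneous 0) (i : Fin 4) :
        (r * MvPolynomial.X i ^ 2).IsHomogeneous 2 := by rw [pow_two, ← mul_assoc]; exact h2 r hr i i
    have h00 : (MvPolynomial.C m * .C n : MvPolynomial (Fin 4) (ZMod p)).IsHomogeneous 0 :=
      (hC m).mul (hC n)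
    simp only [f, normForm]
    refine .add (.add (.add (.add (.add (.add (.add (.add (.add ?_ ?_) ?_) ?_) ?_) ?_) ?_) ?_) ?_) ?_
    · exact (hX 0).pow 2
    · exact h1 _ (hC m) _
    · exact h1 _ (hC n) _
    · exact h1 _ h00 _
    · exact h2 _ (hC t) _ _
    · exact h2 _ (hC u) _ _
    · exact h2 _ (hC w) _ _
    · exact h2 _ (((hC t).mul (hC u)).sub (hC w)) _ _
    · exact h2 _ ((hC m).mul (hC u)) _ _
    · exact h2 _ ((hC n).mul (hC t)) _ _
  have hdvd := char_dvd_card_solutions p (f := f)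
    (hhom.totalDegree_le.trans_lt (by simp))
  have hone : 1 < Fintype.card { x : Fin 4 → ZMod p // MvPolynomial.eval x f = 0 } :=
    (Fact.out : p.Prime).one_lt.trans_le (Nat.le_of_dvd (Fintype.card_pos_iff.2
      ⟨⟨0, by rw [heval]; simp [normForm]⟩⟩) hdvd)
  obtain ⟨⟨c, hc⟩, hne⟩ := Fintype.exists_ne_of_one_lt_card hone
    ⟨0, by rw [heval]; simp [normForm]⟩
  exact ⟨c, fun h => hne (Subtype.ext h), by rw [← heval]; exact hc⟩

/-- If its Gram determinant is a unit at `p`, a zero of the norm form modulo `p` is smooth, and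
Hensel's lemma lifts it to a zero over `ℤ_[p]` that is still smooth. -/
lemma exists_padic_normForm_eq_zero (p : ℕ) [Fact p.Prime] (t u w m n : ℤ)
    (h : ¬ (p : ℤ) ∣ commNorm t u w m n) :
    ∃ c : Fin 4 → ℤ_[p], normForm (t : ℤ_[p]) u w m n c = 0 ∧
      (gram (t : ℤ_[p]) u w m n).mulVec c ≠ 0 := by
  obtain ⟨c, hc0, hc⟩ := exists_normForm_eq_zero p (t : ZMod p) u w m n
  have hdet : (gram (t : ZMod p) u w m n).det ≠ 0 := by
    rw [det_gram]
    refine pow_ne_zero 2 fun h0 => h ?_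
    rw [← ZMod.intCast_zmod_eq_zero_iff_dvd, ← h0]
    simp [commNorm]
  have hG : (gram (t : ZMod p) u w m n).mulVec c ≠ 0 := fun h0 =>
    hdet (Matrix.exists_mulVec_eq_zero_iff.1 ⟨c, hc0, h0⟩)
  obtain ⟨i, hi⟩ := Function.ne_iff.1 hG
  choose C hC using fun j => ZMod.intCast_surjective (c j)
  obtain rfl : (fun j => (C j : ZMod p)) = c := funext hC
  have hQ : (p : ℤ) ∣ normForm t u w m n C := by
    rw [← ZMod.intCast_zmod_eq_zero_iff_dvd, intCast_normForm, hc]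
  have hB : ¬ (p : ℤ) ∣ (gram t u w m n).mulVec C i := by
    rw [← ZMod.intCast_zmod_eq_zero_iff_dvd, intCast_gram_mulVec]
    exact hi
  let F : Polynomial ℤ := .C (normForm t u w m n C) + .C ((gram t u w m n).mulVec C i) * .X
    + .C (normForm t u w m n (Pi.single i 1)) * .X ^ 2
  have hF0 : F.aeval (0 : ℤ_[p]) = (normForm t u w m n C : ℤ) := by simp [F]
  have hF0' : F.derivative.aeval (0 : ℤ_[p]) = ((gram t u w m n).mulVec C i : ℤ) := by simp [F]
  have hn1 : ‖F.derivative.aeval (0 : ℤ_[p])‖ = 1 := by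
    rw [hF0']
    refine le_antisymm (PadicInt.norm_le_one _) (not_lt.1 fun hlt => hB ?_)
    exact (PadicInt.norm_int_lt_one_iff_dvd _).1 hlt
  have hn0 : ‖F.aeval (0 : ℤ_[p])‖ < ‖F.derivative.aeval (0 : ℤ_[p])‖ ^ 2 := by
    rw [hn1, hF0, one_pow]
    exact (PadicInt.norm_int_lt_one_iff_dvd _).2 hQ
  have hsingle : normForm (t : ℤ_[p]) u w m n (Pi.single i 1)
      = (normForm t u w m n (Pi.single i 1) : ℤ) := by
    rw [intCast_normForm]
    congr 1
    ext j
    simp [Pi.single_apply]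
  obtain ⟨s, hs, -, hs', -⟩ := hensels_lemma hn0
  refine ⟨(fun j => (C j : ℤ_[p])) + Pi.single i s, ?_, fun h0 => ?_⟩
  · rw [normForm_add_single, ← intCast_normForm, ← intCast_gram_mulVec, hsingle, ← hs]
    simp [F]
  · have h1 : F.derivative.aeval s = 0 := by
      have h2 := congrFun h0 i
      rw [gram_mulVec_add_single, ← intCast_gram_mulVec, hsingle, Pi.zero_apply] at h2
      rw [← h2]
      simp [F, map_ofNat]
      ring
    rw [h1, norm_zero, hn1] at hs'
    exact zero_ne_one hs'

section Span

variable {R : Type*} [CommRing R] {A B : R}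

/-- The quaternion `c₀ + c₁ x + c₂ y + c₃ xy`. -/
def comb (x y : ℍ[R, A, B]) (c : Fin 4 → R) : ℍ[R, A, B] :=
  c 0 • 1 + c 1 • x + c 2 • y + c 3 • (x * y)

lemma comb_mul_star (x y : ℍ[R, A, B]) (c : Fin 4 → R) :
    (comb x y c * star (comb x y c)).re
      = normForm (2 * x.re) (2 * y.re) (2 * (x * y).re) (x * star x).re (y * star y).re c := by
  simp [comb, normForm]
  ring

lemma gram_mulVec (x y : ℍ[R, A, B]) (c : Fin 4 → R) (i : Fin 4) :
    (gram (2 * x.re) (2 * y.re) (2 * (x * y).re) (x * star x).re (y * star y).re).mulVec c i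
      = 2 * (comb x y c * star (![1, x, y, x * y] i)).re := by
  fin_cases i <;>
    simp [comb, gram, Matrix.mulVec, dotProduct, Fin.sum_univ_succ] <;> ring

lemma commutator_mul_star (x y : ℍ[R, A, B]) :
    ((x * y - y * x) * star (x * y - y * x)).re
      = commNorm (2 * x.re) (2 * y.re) (2 * (x * y).re) (x * star x).re (y * star y).re := by
  simp [commNorm]
  ring

lemma mul_star_eq_zero_of_re {z : ℍ[R, A, B]} (h : (z * star z).re = 0) : z * star z = 0 := by
  rw [QuaternionAlgebra.mul_star_eq_coe, h]; rfl

end Span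

/-- The residue algebra at a ramified prime `p` is commutative, that is, commutators in an order
have norm divisible by `p`. Otherwise the norm form on the lattice spanned by `1, x, y, xy` is
nondegenerate modulo `p`, hence isotropic over `ℤ_[p]`. -/
lemma dvd_nrd_commutator {p : ℕ} [Fact p.Prime] (hp : IsRamifiedOver a b ℚ_[p])
    {O : Subring ℍ[ℚ, a, b]} (hO : IsOrder O) {x y : ℍ[ℚ, a, b]} (hx : x ∈ O) (hy : y ∈ O) :
    ∃ k : ℤ, nrd (x * y - y * x) = p * k := by
  obtain ⟨⟨t, ht⟩, m, hm⟩ := exists_int_trd_nrd hO hx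
  obtain ⟨⟨u, hu⟩, n, hn⟩ := exists_int_trd_nrd hO hy
  obtain ⟨⟨w, hw⟩, -⟩ := exists_int_trd_nrd hO (O.mul_mem hx hy)
  have hnrd : nrd (x * y - y * x) = (commNorm t u w m n : ℤ) := by
    rw [nrd, commutator_mul_star]
    change commNorm (trd x) (trd y) (trd (x * y)) (nrd x) (nrd y) = _
    rw [ht, hm, hu, hn, hw]
    simp [commNorm]
  by_cases hdvd : (p : ℤ) ∣ commNorm t u w m n
  · obtain ⟨k, hk⟩ := hdvd
    exact ⟨k, by rw [hnrd, hk]; push_cast; rfl⟩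
  exfalso
  obtain ⟨c, hc, hne⟩ := exists_padic_normForm_eq_zero p t u w m n hdvd
  let f : ℚ →+* ℚ_[p] := algebraMap ℚ ℚ_[p]
  let X : BaseChange a b ℚ_[p] := ⟨f x.re, f x.imI, f x.imJ, f x.imK⟩
  let Y : BaseChange a b ℚ_[p] := ⟨f y.re, f y.imI, f y.imJ, f y.imK⟩
  have hX : 2 * X.re = ((t : ℤ_[p]) : ℚ_[p]) := by
    have := congrArg f ht
    simpa [trd, X] using this
  have hY : 2 * Y.re = ((u : ℤ_[p]) : ℚ_[p]) := by
    have := congrArg f hu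
    simpa [trd, Y] using this
  have hXY : 2 * (X * Y).re = ((w : ℤ_[p]) : ℚ_[p]) := by
    have := congrArg f hw
    simpa [trd, X, Y, f] using this
  have hXX : (X * star X).re = ((m : ℤ_[p]) : ℚ_[p]) := by
    have := congrArg f hm
    simpa [nrd, X, f] using this
  have hYY : (Y * star Y).re = ((n : ℤ_[p]) : ℚ_[p]) := by
    have := congrArg f hn
    simpa [nrd, Y, f] using this
  let C : Fin 4 → ℚ_[p] := fun j => c j
  have hzero : comb X Y C * star (comb X Y C) = 0 := by
    apply mul_star_eq_zero_of_re
    rw [comb_mul_star, hX, hY, hXY, hXX, hYY]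
    have := congrArg (fun r : ℤ_[p] => (r : ℚ_[p])) hc
    simpa [normForm, C] using this
  have hcomb : comb X Y C ≠ 0 := by
    intro h0
    refine hne (funext fun i => PadicInt.ext ?_)
    have h1 := gram_mulVec X Y C i
    rw [h0, zero_mul, QuaternionAlgebra.re_zero, mul_zero, hX, hY, hXY, hXX, hYY] at h1
    rw [Pi.zero_apply, PadicInt.coe_zero, ← h1]
    have htwo : ((2 : ℤ_[p]) : ℚ_[p]) = 2 := by norm_cast
    fin_cases i <;> simp [gram, Matrix.mulVec, dotProduct, Fin.sum_univ_succ, C, htwo]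
  have h1 := (hp _ hcomb).mul_right_eq_zero.1 hzero
  exact hcomb (star_eq_zero.1 h1)

/-! ### Two quadratic elements of the same trace and norm -/

/-- Multiplication by the distance maps `O'` into `O`. -/
lemma orderDist_nsmul_mem (O O' : Subring ℍ[ℚ, a, b]) {y : ℍ[ℚ, a, b]} (hy : y ∈ O') :
    (orderDist O O' : ℍ[ℚ, a, b]) * y ∈ O := by
  have h := ((O ⊓ O').toAddSubgroup.addSubgroupOf O'.toAddSubgroup).nsmul_index_mem ⟨y, hy⟩
  rw [AddSubgroup.mem_addSubgroupOf] at h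
  have h2 := (show _ ∈ O ⊓ O' from h).1
  rw [← nsmul_eq_mul]
  exact h2

lemma mem_of_coprime_mul_mem (O : Subring ℍ[ℚ, a, b]) {y : ℍ[ℚ, a, b]} {k l : ℕ}
    (hkl : k.Coprime l) (hk : (k : ℍ[ℚ, a, b]) * y ∈ O) (hl : (l : ℍ[ℚ, a, b]) * y ∈ O) :
    y ∈ O := by
  obtain ⟨r, s, hrs⟩ := Nat.isCoprime_iff_coprime.2 hkl
  have h := O.add_mem (O.zsmul_mem hk r) (O.zsmul_mem hl s)
  have h2 : r • ((k : ℍ[ℚ, a, b]) * y) + s • ((l : ℍ[ℚ, a, b]) * y) = y := by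
    rw [zsmul_eq_mul, zsmul_eq_mul, ← mul_assoc, ← mul_assoc, ← add_mul]
    have : (r : ℍ[ℚ, a, b]) * k + s * l = 1 := by exact_mod_cast congrArg (Int.cast) hrs
    rw [this, one_mul]
  rwa [h2] at h

lemma nrd_commutator {x y : ℍ[ℚ, a, b]} (ht : trd x = trd y) (hn : nrd x = nrd y) :
    nrd (x * y - y * x) = nrd (x - y) * nrd (x - star y) := by
  have hre : x.re = y.re := by
    simp only [trd] at ht
    linarith
  have hyx : -a * x.imI ^ 2 - b * x.imJ ^ 2 + a * b * x.imK ^ 2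
      = -a * y.imI ^ 2 - b * y.imJ ^ 2 + a * b * y.imK ^ 2 := by
    simp only [nrd_eq, hre] at hn
    linarith
  simp only [nrd_eq, QuaternionAlgebra.re_sub, QuaternionAlgebra.imI_sub,
    QuaternionAlgebra.imJ_sub, QuaternionAlgebra.imK_sub, QuaternionAlgebra.re_mul,
    QuaternionAlgebra.imI_mul, QuaternionAlgebra.imJ_mul, QuaternionAlgebra.imK_mul,
    QuaternionAlgebra.re_star, QuaternionAlgebra.imI_star, QuaternionAlgebra.imJ_star,
    QuaternionAlgebra.imK_star, hre]
  linear_combination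
    -((-a * x.imI ^ 2 - b * x.imJ ^ 2 + a * b * x.imK ^ 2)
      - (-a * y.imI ^ 2 - b * y.imJ ^ 2 + a * b * y.imK ^ 2)) * hyx

/-- The elements `x` and `y` have the same reduced trace and
norm, so `nrd (x - y)` and `nrd (x - star y)` are positive numbers with sum minus the discriminant;
after multiplication by `l * N` they are integers, whose product is the reduced norm of a commutator
in `O` and so is divisible by `p`. -/
lemma le_of_mem_order {p : ℕ} [Fact p.Prime] (hB : RamifiesExactlyAt a b p)
    {O : Subring ℍ[ℚ, a, b]} (hO : IsOrder O) {x y : ℍ[ℚ, a, b]} {t n : ℤ}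
    (hxt : trd x = t) (hyt : trd y = t) (hxn : nrd x = n) (hyn : nrd y = n)
    {l N : ℕ} (hl : l ≠ 0) (hN : N ≠ 0) (hx : (l : ℍ[ℚ, a, b]) * x ∈ O)
    (hy : (N : ℍ[ℚ, a, b]) * y ∈ O) (hy' : (N : ℍ[ℚ, a, b]) * star y ∈ O)
    (hne : x ≠ y) (hne' : x ≠ star y) : (p : ℚ) ≤ N * (4 * l * n) := by
  obtain ⟨ha, hb⟩ := neg_of_isRamifiedOver_real hB.infinite_place
  have hp : IsRamifiedOver a b ℚ_[p] := (hB.finite_places p).2 rfl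
  have hl0 : (0 : ℚ) < l := by exact_mod_cast Nat.pos_of_ne_zero hl
  have hN0 : (0 : ℚ) < N := by exact_mod_cast Nat.pos_of_ne_zero hN
  have h1 := nrd_pos ha hb (sub_ne_zero.2 hne)
  have h2 := nrd_pos ha hb (sub_ne_zero.2 hne')
  obtain ⟨⟨s, hs⟩, -⟩ := exists_int_trd_nrd hO (O.mul_mem hx hy)
  obtain ⟨⟨s', hs'⟩, -⟩ := exists_int_trd_nrd hO (O.mul_mem hx hy')
  obtain ⟨k, hk⟩ := dvd_nrd_commutator hp hO hx hy
  have e1 : ((2 * n * l * N - s' : ℤ) : ℚ) = l * N * nrd (x - y) := by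
    push_cast
    rw [← hs', show 2 * (n : ℚ) = nrd x + nrd y by rw [hxn, hyn]; ring]
    simp [nrd_eq, trd]
    ring
  have e2 : ((2 * n * l * N - s : ℤ) : ℚ) = l * N * nrd (x - star y) := by
    push_cast
    rw [← hs, show 2 * (n : ℚ) = nrd x + nrd y by rw [hxn, hyn]; ring]
    simp [nrd_eq, trd]
    ring
  have hprod : nrd ((l : ℍ[ℚ, a, b]) * x * ((N : ℍ[ℚ, a, b]) * y)
      - (N : ℍ[ℚ, a, b]) * y * ((l : ℍ[ℚ, a, b]) * x))
      = (l * N * nrd (x - y)) * (l * N * nrd (x - star y)) := by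
    have hc : (l : ℍ[ℚ, a, b]) * x * ((N : ℍ[ℚ, a, b]) * y)
        - (N : ℍ[ℚ, a, b]) * y * ((l : ℍ[ℚ, a, b]) * x)
        = (l : ℍ[ℚ, a, b]) * ((N : ℍ[ℚ, a, b]) * (x * y - y * x)) := by
      rw [mul_assoc, mul_assoc, ← mul_assoc x, ← mul_assoc y, ← (Nat.cast_commute N x).eq,
        ← (Nat.cast_commute l y).eq, mul_sub, mul_sub, mul_assoc, mul_assoc, ← mul_assoc _ _ (y * x),
        ← mul_assoc _ _ (y * x), (Nat.cast_commute N (l : ℍ[ℚ, a, b])).eq]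
    have hcast (r : ℕ) : nrd (r : ℍ[ℚ, a, b]) = r ^ 2 := by simp [nrd_eq]
    rw [hc, nrd_mul, nrd_mul, hcast, hcast,
      nrd_commutator (hxt.trans hyt.symm) (hxn.trans hyn.symm)]
    ring
  have hsum : l * N * nrd (x - y) + l * N * nrd (x - star y) = l * N * (4 * n - t ^ 2) := by
    rw [← hxt, show 4 * (n : ℚ) = 2 * nrd x + 2 * nrd y by rw [hxn, hyn]; ring]
    have hre : x.re = y.re := by
      have := hxt.trans hyt.symm
      simp only [trd] at this
      linarith
    simp [nrd_eq, trd, hre]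
    ring
  rw [← e1] at hprod hsum
  rw [← e2] at hprod hsum
  rw [hk] at hprod
  have hprodZ : (p : ℤ) * k = (2 * n * l * N - s') * (2 * n * l * N - s) := by
    exact_mod_cast hprod
  have p1 : (0 : ℤ) < 2 * n * l * N - s' := by
    have : (0 : ℚ) < ((2 * n * l * N - s' : ℤ) : ℚ) := by rw [e1]; positivity
    exact_mod_cast this
  have p2 : (0 : ℤ) < 2 * n * l * N - s := by
    have : (0 : ℚ) < ((2 * n * l * N - s : ℤ) : ℚ) := by rw [e2]; positivity
    exact_mod_cast this
  have hle : (p : ℤ) ≤ (2 * n * l * N - s') + (2 * n * l * N - s) := by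
    have hpp : Prime (p : ℤ) := Nat.prime_iff_prime_int.1 Fact.out
    rcases hpp.dvd_or_dvd (Dvd.intro _ hprodZ) with h | h
    · linarith [Int.le_of_dvd p1 h]
    · linarith [Int.le_of_dvd p2 h]
  have hleQ : (p : ℚ) ≤ ((2 * n * l * N - s' : ℤ) : ℚ) + ((2 * n * l * N - s : ℤ) : ℚ) := by
    exact_mod_cast hle
  have : (0 : ℚ) ≤ l * N * t ^ 2 := by positivity
  linarith

/-! ### Embedded quadratic orders -/

/-- An injective ring homomorphism into the quaternions carries the quadratic equation of an
irrational element to the reduced trace and norm of its image. -/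
lemma trd_nrd_map {R : Type*} [Ring R] (ψ : R →+* ℍ[ℚ, a, b]) (hψ : Function.Injective ψ)
    {x : R} (hx : ∀ r s : ℤ, s ≠ 0 → (s : R) * x ≠ r) {t n : ℤ} (h : x * x = t * x - n) :
    trd (ψ x) = t ∧ nrd (ψ x) = n := by
  refine trd_nrd_eq_of_sq_eq (fun q hq => ?_) ?_
  · refine hx q.num q.den (by exact_mod_cast q.den_ne_zero) (hψ ?_)
    rw [map_mul, hq, map_intCast, map_intCast, Int.cast_natCast,
      ← map_natCast (algebraMap ℚ ℍ[ℚ, a, b]), ← map_mul, Rat.den_mul_eq_num, map_intCast]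
  · rw [← map_mul, h]
    simp

/-- An algebraic integer that is not a rational integer is irrational. -/
lemma mul_ne_intCast_of_notMem {K : Type*} [Field K] [NumberField K] {β : 𝓞 K}
    (hβ : β ∉ Set.range (algebraMap ℤ (𝓞 K))) (r s : ℤ) (hs : s ≠ 0) : (s : 𝓞 K) * β ≠ r := by
  intro h
  have hsK : (s : K) ≠ 0 := by exact_mod_cast hs
  have hK : (s : K) * (β : K) = r := by
    have := congrArg (algebraMap (𝓞 K) K) h
    simpa using this
  have h1 : (β : K) = algebraMap ℚ K (r / s) := by
    rw [map_div₀, map_intCast, map_intCast, eq_div_iff hsK, mul_comm, hK]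
  have hint : IsIntegral ℤ (algebraMap ℚ K (r / s)) := h1 ▸ β.isIntegral_coe
  obtain ⟨m, hm⟩ := IsIntegrallyClosed.isIntegral_iff.1
    ((isIntegral_algebraMap_iff (algebraMap ℚ K).injective).1 hint)
  refine hβ ⟨m, NumberField.RingOfIntegers.ext ?_⟩
  rw [h1, ← hm]
  simp

/-- `β` does not lie in `ℤ[ℓ β] = ℤ + ℤ ℓ β`. -/
lemma notMem_adjoin {R : Type*} [CommRing R] {β : R}
    (hβ : ∀ r s : ℤ, s ≠ 0 → (s : R) * β ≠ r) {t n : ℤ} (h : β * β = t * β - n)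
    {l : ℕ} (hl : l.Prime) : β ∉ Algebra.adjoin ℤ {(l : R) * β} := by
  have key : ∀ w ∈ Algebra.adjoin ℤ {(l : R) * β}, ∃ r s : ℤ, w = r + s * (l * β) := by
    intro w hw
    induction hw using Algebra.adjoin_induction with
    | mem x hx => exact ⟨0, 1, by rw [Set.mem_singleton_iff.1 hx]; simp⟩
    | algebraMap r => exact ⟨r, 0, by simp⟩
    | add x y _ _ hx hy =>
      obtain ⟨r, s, rfl⟩ := hx
      obtain ⟨r', s', rfl⟩ := hy
      exact ⟨r + r', s + s', by push_cast; ring⟩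
    | mul x y _ _ hx hy =>
      obtain ⟨r, s, rfl⟩ := hx
      obtain ⟨r', s', rfl⟩ := hy
      refine ⟨r * r' - s * s' * l ^ 2 * n, r * s' + r' * s + s * s' * l * t, ?_⟩
      push_cast
      linear_combination (s : R) * s' * l ^ 2 * h
  intro hmem
  obtain ⟨r, s, hrs⟩ := key β hmem
  refine hβ r (1 - s * l) (fun h0 => ?_) ?_
  · have : (l : ℤ) ∣ 1 := ⟨s, by linarith⟩
    exact hl.one_lt.ne' (by exact_mod_cast Int.eq_one_of_dvd_one (by positivity) this)
  · push_cast
    linear_combination hrs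

/-- A quadratic field generated by `θ` embeds into every algebra with a root of the quadratic
equation of `θ`. -/
lemma nonempty_algHom_of_quadratic {K : Type*} [Field K] [NumberField K]
    (hK : Module.finrank ℚ K = 2) {θ : K} (hθ : θ ∉ (algebraMap ℚ K).range) {A : Type*} [Ring A]
    [Algebra ℚ A] {y : A} {t n : ℤ} (h : θ * θ = t * θ - n) (hy : y * y = t * y - n) :
    Nonempty (K →ₐ[ℚ] A) := by
  have hint : IsIntegral ℚ θ := .of_finite ℚ θ
  have h2 : 2 ≤ (minpoly ℚ θ).natDegree := (minpoly.two_le_natDegree_iff hint).2 hθ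
  have hdeg : (minpoly ℚ θ).natDegree = 2 :=
    le_antisymm (hK ▸ minpoly.natDegree_le θ) h2
  let g : Polynomial ℚ := .X ^ 2 + (.C (-t : ℚ) * .X + .C (n : ℚ))
  have hgd : (Polynomial.C (-t : ℚ) * .X + .C (n : ℚ)).degree < ((2 : ℕ) : WithBot ℕ) :=
    lt_of_le_of_lt Polynomial.degree_linear_le (by decide)
  have hg : g.Monic := Polynomial.monic_X_pow_add hgd
  have hgθ : Polynomial.aeval θ g = 0 := by
    simp only [g, map_add, map_mul, Polynomial.aeval_X, Polynomial.aeval_C, map_neg]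
    simp only [map_pow, Polynomial.aeval_X, map_intCast]
    linear_combination h
  have hmin : minpoly ℚ θ = g := by
    refine (minpoly.unique_of_degree_le_degree_minpoly ℚ θ hg hgθ ?_).symm
    rw [Polynomial.degree_eq_natDegree (minpoly.ne_zero hint), hdeg,
      Polynomial.degree_add_eq_left_of_degree_lt (hgd.trans_eq (Polynomial.degree_X_pow 2).symm),
      Polynomial.degree_X_pow]
  have htop : IntermediateField.adjoin ℚ {θ} = ⊤ :=
    (Field.primitive_element_iff_minpoly_natDegree_eq ℚ θ).2 (hdeg.trans hK.symm)
  let pb := IntermediateField.adjoin.powerBasis hint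
  have hroot : Polynomial.aeval y (minpoly ℚ pb.gen) = 0 := by
    have hgen : minpoly ℚ pb.gen = g := (IntermediateField.minpoly_gen ℚ θ).trans hmin
    rw [hgen]
    simp only [g, map_add, map_mul, Polynomial.aeval_X, Polynomial.aeval_C, map_neg]
    simp [pow_two, hy]
  exact ⟨(pb.lift y hroot).comp ((IntermediateField.equivOfEq htop).symm.toAlgHom.comp
    IntermediateField.topEquiv.symm.toAlgHom)⟩

lemma exists_mem_natCast_mul_eq {L : Subring ℍ[ℚ, a, b]} (hL : IsField L) {l : ℕ} (hl : l ≠ 0)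
    {y : ℍ[ℚ, a, b]} (hy : y ∈ L) : ∃ x ∈ L, (l : ℍ[ℚ, a, b]) * x = y := by
  have hl0 : (l : L) ≠ 0 := fun h => by
    have h2 := congrArg (fun z : L => (z : ℍ[ℚ, a, b]).re) h
    simp at h2
    exact hl h2
  obtain ⟨c, hc⟩ := hL.mul_inv_cancel hl0
  refine ⟨c * y, L.mul_mem c.2 hy, ?_⟩
  have hc' := congrArg (Subtype.val) hc
  simp at hc'
  rw [← mul_assoc, hc', one_mul]

end QuatOrder

open QuatOrder in
theorem propositionE1
    -- the quaternion algebra over `ℚ` ramified exactly at `p` and `∞`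
    (p : ℕ) [Fact p.Prime] (a b : ℚ) (hB : QuatOrder.RamifiesExactlyAt a b p)
    -- an imaginary quadratic field `K`, and `β` in its ring of integers generating a quadratic order
    (K : Type*) [Field K] [NumberField K] [NumberField.IsTotallyComplex K]
    (hK : Module.finrank ℚ K = 2)
    (β : 𝓞 K) (hβ : β ∉ Set.range (algebraMap ℤ (𝓞 K)))
    (ℓ : ℕ) (hℓ : ℓ.Prime)
    (O O' : Subring ℍ[ℚ, a, b])
    (hO : QuatOrder.IsMaximalOrder O) (hO' : QuatOrder.IsMaximalOrder O')
    (hemb : QuatOrder.IsOptimallyEmbedded (Algebra.adjoin ℤ {(ℓ : 𝓞 K) * β}) O)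
    (hemb' : QuatOrder.IsOptimallyEmbedded (Algebra.adjoin ℤ {β}) O')
    (hd : ¬ ℓ ∣ QuatOrder.orderDist O O') :
    -- `nrd β` means the reduced norm of the image of `β` under any embedding of `K`
    Nonempty (K →ₐ[ℚ] ℍ[ℚ, a, b]) ∧
      ∀ ι : K →ₐ[ℚ] ℍ[ℚ, a, b],
        (p : ℚ) / (4 * (ℓ : ℚ) * QuatOrder.nrd (ι (β : K))) ≤ (QuatOrder.orderDist O O' : ℚ) := by
  obtain ⟨L, hL, ⟨φ⟩⟩ := hemb
  obtain ⟨L', -, ⟨φ'⟩⟩ := hemb'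
  have hirr := mul_ne_intCast_of_notMem hβ
  have hℓ0 : (ℓ : 𝓞 K) ≠ 0 := by exact_mod_cast hℓ.ne_zero
  -- the image `y` of `β` in `O'`
  let β₀ : Algebra.adjoin ℤ {β} := ⟨β, Algebra.self_mem_adjoin_singleton ℤ β⟩
  let y : ℍ[ℚ, a, b] := φ' β₀
  have hyO' : y ∈ O' := (φ' β₀).2.1
  obtain ⟨⟨t, ht⟩, n, hn⟩ := exists_int_trd_nrd hO'.1 hyO'
  have hyq : y * y = t * y - n := by
    rw [sq_eq, ht, hn, map_intCast, map_intCast]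
  have hβq : β * β = t * β - n := by
    have h : β₀ * β₀ = t * β₀ - n := by
      apply φ'.injective
      apply Subtype.coe_injective
      rw [map_mul, map_sub, map_mul, map_intCast, map_intCast]
      exact hyq
    exact congrArg Subtype.val h
  have hβK : (β : K) * β = t * β - n := by
    have := congrArg (algebraMap (𝓞 K) K) hβq
    simpa using this
  have hirrK (r s : ℤ) (hs : s ≠ 0) : (s : K) * β ≠ r := fun h =>
    hirr r s hs (NumberField.RingOfIntegers.ext (by simpa using h))
  -- `ℓ x` is the image of `ℓ β` in `O`; the quotient `x` exists because `L` is a field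
  let γ₀ : Algebra.adjoin ℤ {(ℓ : 𝓞 K) * β} := ⟨ℓ * β, Algebra.self_mem_adjoin_singleton ℤ _⟩
  obtain ⟨x, hxL, hx⟩ := exists_mem_natCast_mul_eq hL hℓ.ne_zero (φ γ₀).2.2
  have hxO : (ℓ : ℍ[ℚ, a, b]) * x ∈ O := hx ▸ (φ γ₀).2.1
  have hxtn : trd x = t ∧ nrd x = n := by
    have hγ : γ₀ * γ₀ = (ℓ * t : ℤ) * γ₀ - (ℓ ^ 2 * n : ℤ) := by
      apply Subtype.coe_injective
      change (ℓ * β) * (ℓ * β) = ((ℓ * t : ℤ) : 𝓞 K) * (ℓ * β) - ((ℓ ^ 2 * n : ℤ) : 𝓞 K)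
      push_cast
      linear_combination (ℓ : 𝓞 K) ^ 2 * hβq
    have hγirr (r s : ℤ) (hs : s ≠ 0) : (s : Algebra.adjoin ℤ {(ℓ : 𝓞 K) * β}) * γ₀ ≠ r := by
      intro h
      refine hirr r (s * ℓ) (mul_ne_zero hs (by exact_mod_cast hℓ.ne_zero)) ?_
      have h2 : (s : 𝓞 K) * (ℓ * β) = r := congrArg Subtype.val h
      push_cast
      rw [mul_assoc, h2]
    have h := trd_nrd_map ((O ⊓ L).subtype.comp φ.toRingHom)
      (Subtype.coe_injective.comp φ.injective) hγirr hγ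
    change trd (φ γ₀ : ℍ[ℚ, a, b]) = _ ∧ nrd (φ γ₀ : ℍ[ℚ, a, b]) = _ at h
    have hℓQ : (ℓ : ℚ) ≠ 0 := by exact_mod_cast hℓ.ne_zero
    have h1 := h.1
    have h2 := h.2
    rw [← hx] at h1 h2
    rw [nrd_mul] at h2
    push_cast at h1 h2
    constructor
    · simp [trd] at h1
      refine mul_left_cancel₀ hℓQ ?_
      rw [← h1, trd]; ring
    · refine mul_left_cancel₀ (pow_ne_zero 2 hℓQ) ?_
      rw [← h2]
      simp [nrd_eq]
  -- optimality of the embedding of `ℤ[ℓ β]`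
  have hxnot : x ∉ O := by
    intro hmem
    obtain ⟨w, hw⟩ := φ.surjective ⟨x, hmem, hxL⟩
    have h : (ℓ : Algebra.adjoin ℤ {(ℓ : 𝓞 K) * β}) * w = γ₀ := by
      apply φ.injective
      apply Subtype.coe_injective
      rw [map_mul, hw, map_natCast]
      exact hx
    have h2 : (ℓ : 𝓞 K) * w = ℓ * β := congrArg Subtype.val h
    have h3 : (w : 𝓞 K) = β := mul_left_cancel₀ hℓ0 h2
    have h4 : (w : 𝓞 K) ∈ Algebra.adjoin ℤ {(ℓ : 𝓞 K) * β} := w.2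
    exact notMem_adjoin hirr hβq hℓ (by rwa [h3] at h4)
  have hcop : ℓ.Coprime (orderDist O O') := (Nat.Prime.coprime_iff_not_dvd hℓ).2 hd
  have hstar : star y = t - y := by
    rw [eq_sub_iff_add_eq, add_comm, add_star_self, ht, map_intCast]
  have hyO := orderDist_nsmul_mem O O' hyO'
  have hyO2 : (orderDist O O' : ℍ[ℚ, a, b]) * star y ∈ O :=
    orderDist_nsmul_mem O O' (hstar ▸ O'.sub_mem (intCast_mem O' t) hyO')
  -- if `x` were `y` or its conjugate, then both `ℓ x` and `N x` would lie in `O`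
  have hne : x ≠ y := fun h =>
    hxnot (mem_of_coprime_mul_mem O hcop hxO (h ▸ hyO))
  have hne' : x ≠ star y := fun h =>
    hxnot (mem_of_coprime_mul_mem O hcop hxO (h ▸ hyO2))
  have hbound := le_of_mem_order hB hO.1 hxtn.1 ht hxtn.2 hn hℓ.ne_zero
    (fun h0 => hd (by rw [h0]; exact dvd_zero ℓ)) hxO hyO hyO2 hne hne'
  have hn0 : (0 : ℚ) < n := by
    obtain ⟨ha, hb⟩ := neg_of_isRamifiedOver_real hB.infinite_place
    rw [← hxtn.2]
    exact nrd_pos ha hb fun h => hxnot (h ▸ O.zero_mem)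
  have hℓpos : (0 : ℚ) < ℓ := by exact_mod_cast hℓ.pos
  refine ⟨nonempty_algHom_of_quadratic hK ?_ hβK hyq, fun ι => ?_⟩
  · rintro ⟨q, hq⟩
    refine hirrK q.num q.den (by exact_mod_cast q.den_ne_zero) ?_
    rw [← hq, Int.cast_natCast, ← map_natCast (algebraMap ℚ K), ← map_mul, Rat.den_mul_eq_num,
      map_intCast]
  · have hι := (trd_nrd_map ι.toRingHom ι.toRingHom.injective hirrK hβK).2
    change nrd (ι (β : K)) = n at hι
    rw [hι]
    exact (div_le_iff₀ (by positivity)).2 hbound
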